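/- Let $d\ge 0$ be an integer and let $E\subset\mathbb{R}^d$ be a non-empty compact set. For a non-empty bounded set $A\subset\mathbb{R}^d$ let $N_r(A)$ be the least number of sets of diameter at most $r$ that cover $A$, let $$\underline{\dim}_{B}A=\liminf_{r\to0^+}\frac{\log N_r(A)}{-\log r},$$ and define the modified lower box dimension of $E$ by $$\underline{\dim}_{MB}E=\inf\Big\{\sup_{i}\underline{\dim}_{B}E_i:\ E\subset\bigcup_{i=1}^\infty E_i,\ \text{each } E_i\subset\mathbb{R}^d \text{ non-empty and compact}\Big\}.$$ For a Borel probability measure $\mu$ on $\mathbb{R}^d$ let $\operatorname{spt}\mu$ be its (closed, topological) support and $\widehat\mu(z)=\int e^{ix\cdot z}\,d\mu(x)$. Then $$\underline{\dim}_{MB}E=\sup_{F\subset E}\ \inf_{R_k\nearrow\infty}\ \sup_{\mu:\,\operatorname{spt}\mu=F}\ \limsup_{k\to\infty}\frac{\log\Big(R_k^{-d}\int_{|z|\le R_k}|\widehat\mu(z)|^2\,dz\Big)}{-\log R_k}.$$ Here the first supremum is over all subsets $F$ of $E$, the infimum is over all non-decreasing real sequences $(R_k)$ tending to $\infty$, and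 the second supremum is over all Borel probability measures $\mu$ on $\mathbb{R}^d$ with $\operatorname{spt}\mu=F$. The suprema and infima are taken in $[-\infty,\infty]$ with $\sup\emptyset=-\infty$, so that only non-empty closed $F$ contribute. -/

import Mathlib

open MeasureTheory Filter Topology Set

namespace FractalDim

/-- `coverNum r A`: the least number of sets of diameter at most `r` that cover `A`.
(For bounded `A` in Euclidean space and `r > 0` such finite covers exist.) -/
noncomputable def coverNum {d : ℕ} (r : ℝ) (A : Set (EuclideanSpace ℝ (Fin d))) : ℕ :=
  sInf {n : ℕ | ∃ U : Fin n → Set (EuclideanSpace ℝ (Fin d)),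
    (∀ i, Metric.ediam (U i) ≤ ENNReal.ofReal r) ∧ A ⊆ ⋃ i, U i}

/-- The lower box-counting dimension of a non-empty bounded set,
`liminf_{r → 0+} log N_r(A) / (- log r)`. -/
noncomputable def lowerBoxDim {d : ℕ} (A : Set (EuclideanSpace ℝ (Fin d))) : EReal :=
  liminf (fun r : ℝ => ((Real.log (coverNum r A : ℝ) / (-Real.log r) : ℝ) : EReal)) (𝓝[>] 0)

/-- The modified lower box dimension: the infimum of `sup_i lowerBoxDim (C i)` over all
countable covers of `A` by (non-empty) compact sets `C i`. -/
noncomputable def modLowerBoxDim {d : ℕ} (A : Set (EuclideanSpace ℝ (Fin d))) : EReal :=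
  ⨅ (C : ℕ → Set (EuclideanSpace ℝ (Fin d)))
    (_ : (∀ i, IsCompact (C i) ∧ (C i).Nonempty) ∧ A ⊆ ⋃ i, C i), ⨆ i, lowerBoxDim (C i)

/-- `log (R^{-d} ∫_{|z| ≤ R} |μ̂(z)|² dz) / (- log R)`, where
`μ̂(z) = charFun μ z = ∫ exp (i x·z) dμ(x)`. For a probability measure `μ` and `R > 0`, the
integral is finite and positive. -/
noncomputable def fourierExponent {d : ℕ} (μ : Measure (EuclideanSpace ℝ (Fin d))) (R : ℝ) : ℝ :=
  Real.log ((R ^ d)⁻¹ * ∫ z in Metric.closedBall (0 : EuclideanSpace ℝ (Fin d)) R,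
    ‖charFun μ z‖ ^ 2) / (-Real.log R)

end FractalDim

/-! The averaged energy of `μ` at radius `R` measures the `μ × μ`-mass within distance `1/R` of the
diagonal. Two estimates link it to covering numbers. If `A` is compact, Cauchy–Schwarz over a cover
gives energy at least `c μ(A)² / N_{1/R}(A)` (`energy_ge_coverNum`). Conversely, the uniform measure
on `N` points that are `1/R`-separated has energy at most `C / N` (`exists_energy_uniform_bound`, a
Plancherel argument with disjoint bumps).

Fourier side ≤ dimension: let compact sets `C i` cover `E`, and let `F ⊆ E` be a support. By Baire,
one `C i` contains a relatively open piece of `F`, so every measure with support `F` charges it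
(`exists_forall_measure_pos`). The index does not depend on `μ`, so `R_k` can be chosen first, along
scales that nearly realise the liminf for that `C i`.

Dimension ≤ Fourier side: for `s` below the dimension, delete from `E` the points near which it is
covered by countably many compact sets of dimension at most `s`. Every local piece of the remaining
compact `F` has lower box dimension above `s` (`exists_core`). So at every large `R_k`, and near any
point of `F`, there are uniform measures of energy below `R_k^{-t}`, where `t < s`. Energy is
convex, so mixtures inherit this bound, and mixtures are weakly dense. The measures with small
energy at some `k ≥ n` thus form an open dense set (`dense_setOf_energy_lt`), and a generic measure
has small energy infinitely often together with support exactly `F`. -/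

namespace FractalDim

variable {d : ℕ}

/-- The mean of `|μ̂|²` over the ball of radius `R`, normalised by `R ^ d`. -/
noncomputable def energy (μ : Measure (EuclideanSpace ℝ (Fin d))) (R : ℝ) : ℝ :=
  (R ^ d)⁻¹ * ∫ z in Metric.closedBall (0 : EuclideanSpace ℝ (Fin d)) R, ‖charFun μ z‖ ^ 2

lemma fourierExponent_eq (μ : Measure (EuclideanSpace ℝ (Fin d))) (R : ℝ) :
    fourierExponent μ R = Real.log (energy μ R) / (-Real.log R) := rfl

/-! ### Fourier duality and the near-diagonal lower bound for the energy -/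

section Duality

variable {V : Type*} [NormedAddCommGroup V] [InnerProductSpace ℝ V] [MeasurableSpace V]
  [BorelSpace V] [SecondCountableTopology V]

lemma integral_charFun_comm (μ ν : Measure V) [IsFiniteMeasure μ] [IsFiniteMeasure ν] :
    ∫ t, charFun μ t ∂ν = ∫ t, charFun ν t ∂μ := by
  simp only [charFun_apply]
  rw [integral_integral_swap]
  · simp only [real_inner_comm]
  · apply Integrable.of_bound (C := 1)
    · apply Continuous.aestronglyMeasurable
      simp only [Function.uncurry_def]
      fun_prop
    · filter_upwards with p
      simp [Function.uncurry_def, Complex.norm_exp_ofReal_mul_I]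

/-- The difference of two independent copies has transform `μ̂` times its conjugate. -/
lemma charFun_map_sub (μ : Measure V) [IsFiniteMeasure μ] (t : V) :
    charFun ((μ.prod μ).map fun p => p.1 - p.2) t = ((‖charFun μ t‖ ^ 2 : ℝ) : ℂ) := by
  rw [charFun_apply, integral_map (by fun_prop)
    (Continuous.aestronglyMeasurable (by fun_prop))]
  rw [Complex.ofReal_pow, ← Complex.mul_conj', ← charFun_neg, charFun_apply, charFun_apply,
    ← integral_prod_mul]
  refine integral_congr_ae (Eventually.of_forall fun p => ?_)
  simp only [inner_sub_left, inner_neg_right, ← Complex.exp_add]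
  push_cast
  ring_nf

/-- Fubini for the two difference laws. With `ν` Lebesgue measure on a ball, it trades a frequency
average of `|μ̂|²` for a spatial integral against `μ × μ` with the nonnegative kernel `|ν̂|²`. -/
lemma integral_norm_charFun_sq_comm (μ ν : Measure V) [IsFiniteMeasure μ] [IsFiniteMeasure ν] :
    ∫ p, ‖charFun μ (p.1 - p.2)‖ ^ 2 ∂(ν.prod ν) =
      ∫ p, ‖charFun ν (p.1 - p.2)‖ ^ 2 ∂(μ.prod μ) := by
  have h := integral_charFun_comm ((μ.prod μ).map fun p => p.1 - p.2)
    ((ν.prod ν).map fun p => p.1 - p.2)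
  simp only [charFun_map_sub] at h
  rw [integral_complex_ofReal, integral_complex_ofReal, Complex.ofReal_inj] at h
  rwa [integral_map (by fun_prop), integral_map (by fun_prop)] at h
  · exact ((measurable_charFun (μ := ν)).norm.pow_const 2).aestronglyMeasurable
  · exact ((measurable_charFun (μ := μ)).norm.pow_const 2).aestronglyMeasurable

end Duality

lemma integrableOn_norm_charFun_sq (μ : Measure (EuclideanSpace ℝ (Fin d)))
    [IsProbabilityMeasure μ] (x : EuclideanSpace ℝ (Fin d)) (R : ℝ) :
    IntegrableOn (fun z => ‖charFun μ z‖ ^ 2) (Metric.closedBall x R) := by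
  have : IsFiniteMeasure (volume.restrict (Metric.closedBall x R)) :=
    ⟨by simpa using measure_closedBall_lt_top⟩
  apply Integrable.of_bound (C := 1)
  · exact ((measurable_charFun (μ := μ)).norm.pow_const 2).aestronglyMeasurable
  · filter_upwards with z
    simpa using pow_le_one₀ (n := 2) (norm_nonneg _) (norm_charFun_le_one (μ := μ) z)

/-- There is no cancellation: on the ball of radius `R / 2` the phase is at most `1/2`, so the real
part of the integrand is at least `cos (1/2)`. -/
lemma norm_charFun_restrict_ge {R : ℝ} (hR : 0 < R) {v : EuclideanSpace ℝ (Fin d)}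
    (hv : ‖v‖ ≤ R⁻¹) :
    Real.cos (1 / 2) * volume.real (Metric.closedBall (0 : EuclideanSpace ℝ (Fin d)) (R / 2)) ≤
      ‖charFun (volume.restrict
        (Metric.closedBall (0 : EuclideanSpace ℝ (Fin d)) (R / 2))) v‖ := by
  set B := Metric.closedBall (0 : EuclideanSpace ℝ (Fin d)) (R / 2)
  have hB : IsFiniteMeasure (volume.restrict B) := ⟨by simpa using measure_closedBall_lt_top⟩
  refine le_trans ?_ (Complex.re_le_norm _)
  have hint : Integrable (fun x => Complex.exp (inner ℝ x v * Complex.I)) (volume.restrict B) := by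
    apply Integrable.of_bound (C := 1) (Continuous.aestronglyMeasurable (by fun_prop))
    filter_upwards with p
    simp [Complex.norm_exp_ofReal_mul_I]
  have h1 : (charFun (volume.restrict B) v).re = ∫ x in B, Real.cos (inner ℝ x v) := by
    rw [charFun_apply]
    have := integral_re hint
    simpa [Complex.exp_ofReal_mul_I_re] using this.symm
  rw [h1, mul_comm, ← smul_eq_mul, ← setIntegral_const]
  apply setIntegral_mono_on
  · exact integrableOn_const measure_closedBall_lt_top.ne
  · simpa [IntegrableOn, Complex.exp_ofReal_mul_I_re] using hint.re
  · exact Metric.isClosed_closedBall.measurableSet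
  · intro x hx
    have hx' : ‖x‖ ≤ R / 2 := by simpa [B] using hx
    have h2 : |inner ℝ x v| ≤ 1 / 2 := by
      calc |inner ℝ x v| ≤ ‖x‖ * ‖v‖ := abs_real_inner_le_norm x v
        _ ≤ (R / 2) * R⁻¹ := by gcongr
        _ = 1 / 2 := by field_simp
    rw [← Real.cos_abs (inner ℝ x v)]
    apply Real.cos_le_cos_of_nonneg_of_le_pi (abs_nonneg _) _ h2
    linarith [Real.pi_gt_three]

/-- Constant in the lower bound for the energy. -/
noncomputable def lowerConst (d : ℕ) : ℝ :=
  Real.cos (1 / 2) ^ 2 * ((1 / 2) ^ d *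
    volume.real (Metric.closedBall (0 : EuclideanSpace ℝ (Fin d)) 1))

lemma lowerConst_pos (d : ℕ) : 0 < lowerConst d := by
  have h1 : 0 < Real.cos (1 / 2) :=
    Real.cos_pos_of_mem_Ioo ⟨by linarith [Real.pi_gt_three], by linarith [Real.pi_gt_three]⟩
  have h2 : 0 < volume.real (Metric.closedBall (0 : EuclideanSpace ℝ (Fin d)) 1) :=
    ENNReal.toReal_pos (Metric.measure_closedBall_pos _ _ one_pos).ne'
      measure_closedBall_lt_top.ne
  unfold lowerConst
  positivity

/-- Average `|μ̂(a - b)|²` over `a, b` in the ball `B` of radius `R / 2`. The differences stay in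
the ball of radius `R`, which bounds the average above by `J`; duality bounds it below by
near-diagonal mass. -/
lemma energy_ge_prod (μ : Measure (EuclideanSpace ℝ (Fin d))) [IsProbabilityMeasure μ] {R : ℝ}
    (hR : 0 < R) :
    lowerConst d * (μ.prod μ).real {p | dist p.1 p.2 ≤ R⁻¹} ≤ energy μ R := by
  set B := Metric.closedBall (0 : EuclideanSpace ℝ (Fin d)) (R / 2) with hBdef
  have hBtop : volume B < ⊤ := measure_closedBall_lt_top
  have hB : IsFiniteMeasure (volume.restrict B) := ⟨by simpa using hBtop⟩
  set J := ∫ z in Metric.closedBall (0 : EuclideanSpace ℝ (Fin d)) R, ‖charFun μ z‖ ^ 2 with hJ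
  have hvol : volume.real B = R ^ d * ((1 / 2) ^ d *
      volume.real (Metric.closedBall (0 : EuclideanSpace ℝ (Fin d)) 1)) := by
    rw [hBdef, Measure.real, Measure.addHaar_closedBall' _ _ (by positivity), ENNReal.toReal_mul,
      ENNReal.toReal_ofReal (by positivity)]
    simp [Measure.real, div_eq_mul_inv, mul_pow, mul_assoc]
  have hBpos : 0 < volume.real B :=
    ENNReal.toReal_pos (Metric.measure_closedBall_pos _ _ (by positivity)).ne' hBtop.ne
  have hmeas : Measurable fun p : EuclideanSpace ℝ (Fin d) × EuclideanSpace ℝ (Fin d) =>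
      ‖charFun μ (p.1 - p.2)‖ ^ 2 :=
    ((measurable_charFun (μ := μ)).comp (measurable_fst.sub measurable_snd)).norm.pow_const 2
  have hupper : ∫ p, ‖charFun μ (p.1 - p.2)‖ ^ 2
      ∂((volume.restrict B).prod (volume.restrict B)) ≤ volume.real B * J := by
    have hint : Integrable (fun p : EuclideanSpace ℝ (Fin d) × EuclideanSpace ℝ (Fin d) =>
        ‖charFun μ (p.1 - p.2)‖ ^ 2) ((volume.restrict B).prod (volume.restrict B)) := by
      apply Integrable.of_bound (C := 1) hmeas.aestronglyMeasurable
      filter_upwards with p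
      simpa using pow_le_one₀ (n := 2) (norm_nonneg _) (norm_charFun_le_one (μ := μ) (p.1 - p.2))
    rw [integral_prod_symm _ hint, ← smul_eq_mul, ← setIntegral_const]
    apply setIntegral_mono_on hint.integral_prod_right
    · exact integrableOn_const hBtop.ne
    · exact Metric.isClosed_closedBall.measurableSet
    · intro b hb
      have hpre : (fun a => a - b) ⁻¹' (Metric.closedBall (-b) (R / 2)) = B := by
        ext a; simp [hBdef, dist_eq_norm]
      have := (measurePreserving_sub_right volume b).setIntegral_preimage_emb
        (MeasurableEquiv.subRight b).measurableEmbedding (fun z => ‖charFun μ z‖ ^ 2)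
        (Metric.closedBall (-b) (R / 2))
      rw [hpre] at this
      change ∫ a in B, ‖charFun μ (a - b)‖ ^ 2 ≤ J
      rw [this]
      apply setIntegral_mono_set (integrableOn_norm_charFun_sq μ _ _)
      · filter_upwards with z using by positivity
      · apply LE.le.eventuallyLE
        apply Metric.closedBall_subset_closedBall'
        have : ‖b‖ ≤ R / 2 := by simpa [hBdef] using hb
        simp; linarith
  have hlower : (Real.cos (1 / 2) * volume.real B) ^ 2 *
      (μ.prod μ).real {p | dist p.1 p.2 ≤ R⁻¹} ≤
      ∫ p, ‖charFun (volume.restrict B) (p.1 - p.2)‖ ^ 2 ∂(μ.prod μ) := by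
    have hint : Integrable (fun p : EuclideanSpace ℝ (Fin d) × EuclideanSpace ℝ (Fin d) =>
        ‖charFun (volume.restrict B) (p.1 - p.2)‖ ^ 2) (μ.prod μ) := by
      refine Integrable.of_bound (C := ((volume.restrict B).real univ) ^ 2) ?_ ?_
      · exact (((measurable_charFun (μ := volume.restrict B)).comp
          (measurable_fst.sub measurable_snd)).norm.pow_const 2).aestronglyMeasurable
      · filter_upwards with p
        simpa using pow_le_pow_left₀ (norm_nonneg _)
          (norm_charFun_le (μ := volume.restrict B) (p.1 - p.2)) 2
    have hS : MeasurableSet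
        {p : EuclideanSpace ℝ (Fin d) × EuclideanSpace ℝ (Fin d) | dist p.1 p.2 ≤ R⁻¹} :=
      (isClosed_le (by fun_prop) (by fun_prop)).measurableSet
    rw [mul_comm, ← smul_eq_mul, ← setIntegral_const]
    refine le_trans ?_ (setIntegral_le_integral (s := {p | dist p.1 p.2 ≤ R⁻¹}) hint
      (Eventually.of_forall fun p => by positivity))
    apply setIntegral_mono_on (integrableOn_const (measure_ne_top _ _)) hint.integrableOn hS
    intro p hp
    apply pow_le_pow_left₀
    · have h1 : 0 < Real.cos (1 / 2) :=
        Real.cos_pos_of_mem_Ioo ⟨by linarith [Real.pi_gt_three], by linarith [Real.pi_gt_three]⟩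
      positivity
    · exact norm_charFun_restrict_ge hR (by simpa [dist_eq_norm] using hp)
  have hfin := hlower.trans ((integral_norm_charFun_sq_comm μ (volume.restrict B)).symm.le.trans
    hupper)
  -- The lower bound carries `|B|²` and the upper bound `|B|`; the surviving factor supplies `R ^
  -- d`.
  have h3 : Real.cos (1 / 2) ^ 2 * volume.real B * (μ.prod μ).real {p | dist p.1 p.2 ≤ R⁻¹} ≤ J := by
    refine le_of_mul_le_mul_left ?_ hBpos
    linarith
  rw [hvol] at h3
  unfold energy lowerConst
  rw [le_inv_mul_iff₀ (by positivity)]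
  linarith

/-! ### Covering numbers against energy -/

/-- Split `A` into disjoint pieces of the covering sets: their squares lie near the diagonal, and
Cauchy–Schwarz bounds the sum of squared masses from below. -/
lemma prod_dist_le_ge {X : Type*} [PseudoEMetricSpace X] [MeasurableSpace X] [BorelSpace X]
    [SecondCountableTopology X]
    (μ : Measure X) [IsFiniteMeasure μ] {A : Set X} {n : ℕ} {δ : ENNReal} (hA : MeasurableSet A)
    {U : Fin n → Set X} (hU : ∀ i, Metric.ediam (U i) ≤ δ) (hAU : A ⊆ ⋃ i, U i) :
    μ.real A ^ 2 ≤ n * (μ.prod μ).real {p | edist p.1 p.2 ≤ δ} := by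
  -- Closures make the covering sets measurable without enlarging their diameters.
  set W : Fin n → Set X := fun i => A ∩ closure (U i)
  have hW : ∀ i, MeasurableSet (W i) := fun i => hA.inter isClosed_closure.measurableSet
  set P := disjointed W
  have hP : ∀ i, MeasurableSet (P i) := fun i => by
    rw [show P i = W i \ (Finset.Iio i).sup W from disjointed_apply W i,
      Finset.sup_set_eq_biUnion]
    exact (hW i).diff (Finset.measurableSet_biUnion _ fun j _ => hW j)
  have hdisj : Pairwise (Function.onFun Disjoint P) := disjoint_disjointed W
  have hPU : ⋃ i, P i = A := by
    rw [iUnion_disjointed]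
    apply subset_antisymm (iUnion_subset fun i => inter_subset_left)
    intro x hx
    obtain ⟨i, hi⟩ := mem_iUnion.1 (hAU hx)
    exact mem_iUnion.2 ⟨i, hx, subset_closure hi⟩
  have hsum : μ.real A = ∑ i, μ.real (P i) := by
    rw [← hPU, measureReal_iUnion_fintype hdisj hP]
  have hsq : ∑ i, μ.real (P i) ^ 2 = (μ.prod μ).real (⋃ i, P i ×ˢ P i) := by
    rw [measureReal_iUnion_fintype]
    · exact Finset.sum_congr rfl fun i _ => by rw [measureReal_prod_prod, sq]
    · intro i j hij
      exact Disjoint.set_prod_left (hdisj hij) _ _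
    · exact fun i => (hP i).prod (hP i)
  calc μ.real A ^ 2 ≤ (Finset.univ : Finset (Fin n)).card * ∑ i, μ.real (P i) ^ 2 := by
        rw [hsum]; exact sq_sum_le_card_mul_sum_sq
    _ ≤ _ := by
        rw [hsq, Finset.card_univ, Fintype.card_fin]
        refine mul_le_mul_of_nonneg_left (measureReal_mono (iUnion_subset ?_)) (Nat.cast_nonneg _)
        rintro i ⟨x, y⟩ ⟨hx, hy⟩
        have h1 : x ∈ closure (U i) := (disjointed_subset W i hx).2
        have h2 : y ∈ closure (U i) := (disjointed_subset W i hy).2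
        exact (Metric.edist_le_ediam_of_mem h1 h2).trans (by rw [Metric.ediam_closure]; exact hU i)

lemma exists_cover_of_isCompact {A : Set (EuclideanSpace ℝ (Fin d))} (hA : IsCompact A) {r : ℝ}
    (hr : 0 < r) :
    ∃ U : Fin (coverNum r A) → Set (EuclideanSpace ℝ (Fin d)),
      (∀ i, Metric.ediam (U i) ≤ ENNReal.ofReal r) ∧ A ⊆ ⋃ i, U i := by
  -- Attainment needs some finite cover to exist, as `sInf ∅ = 0`; compactness provides one.
  apply Nat.sInf_mem (s := {n : ℕ | ∃ U : Fin n → Set (EuclideanSpace ℝ (Fin d)),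
    (∀ i, Metric.ediam (U i) ≤ ENNReal.ofReal r) ∧ A ⊆ ⋃ i, U i})
  obtain ⟨t, -, htf, hcov⟩ := hA.finite_cover_balls (half_pos hr)
  have := htf.fintype
  refine ⟨Fintype.card t, fun i => Metric.ball ((Fintype.equivFin t).symm i : _) (r / 2),
    fun i => ?_, fun x hx => ?_⟩
  · beta_reduce
    rw [← Metric.eball_ofReal]
    refine Metric.ediam_eball_le.trans ?_
    rw [← ENNReal.ofReal_ofNat, ← ENNReal.ofReal_mul (by simp)]
    exact ENNReal.ofReal_le_ofReal (by linarith)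
  · obtain ⟨y, hy, hxy⟩ := mem_iUnion₂.1 (hcov hx)
    exact mem_iUnion.2 ⟨Fintype.equivFin t ⟨y, hy⟩, by simpa using hxy⟩

lemma energy_ge_coverNum (μ : Measure (EuclideanSpace ℝ (Fin d))) [IsProbabilityMeasure μ]
    {A : Set (EuclideanSpace ℝ (Fin d))} (hA : IsCompact A) {R : ℝ} (hR : 0 < R) :
    lowerConst d * μ.real A ^ 2 ≤ coverNum R⁻¹ A * energy μ R := by
  obtain ⟨U, hU, hAU⟩ := exists_cover_of_isCompact hA (inv_pos.2 hR)
  have h1 := prod_dist_le_ge μ hA.measurableSet hU hAU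
  have h2 : {p : EuclideanSpace ℝ (Fin d) × EuclideanSpace ℝ (Fin d) |
      edist p.1 p.2 ≤ ENNReal.ofReal R⁻¹} = {p | dist p.1 p.2 ≤ R⁻¹} := by
    ext p
    simp [edist_dist, ENNReal.ofReal_le_ofReal_iff (inv_nonneg.2 hR.le)]
  rw [h2] at h1
  calc lowerConst d * μ.real A ^ 2
      ≤ lowerConst d * (coverNum R⁻¹ A * (μ.prod μ).real {p | dist p.1 p.2 ≤ R⁻¹}) :=
        mul_le_mul_of_nonneg_left h1 (lowerConst_pos d).le
    _ = coverNum R⁻¹ A * (lowerConst d * (μ.prod μ).real {p | dist p.1 p.2 ≤ R⁻¹}) := by ring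
    _ ≤ _ := mul_le_mul_of_nonneg_left (energy_ge_prod μ hR) (Nat.cast_nonneg _)

/-! ### Mean-square bound for exponential sums over separated points -/

lemma sum_sq_eq_of_mul_eq_zero {ι : Type*} (s : Finset ι) (a : ι → ℝ)
    (h : ∀ i ∈ s, ∀ j ∈ s, i ≠ j → a i * a j = 0) : (∑ i ∈ s, a i) ^ 2 = ∑ i ∈ s, a i ^ 2 := by
  rw [sq, Finset.sum_mul_sum]
  refine Finset.sum_congr rfl fun i hi => ?_
  rw [Finset.sum_eq_single i (fun j hj hij => h i hi j hj hij.symm) (fun hn => absurd hi hn), sq]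

lemma le_norm_fourier_bump (f : ContDiffBump (0 : EuclideanSpace ℝ (Fin d)))
    (hf : f.rOut ≤ 1 / 4) {ξ : EuclideanSpace ℝ (Fin d)} (hξ : ‖ξ‖ ≤ (2 * Real.pi)⁻¹) :
    Real.cos (1 / 4) * ∫ x, f x ≤
      ‖∫ x, Complex.exp (↑(-2 * Real.pi * inner ℝ x ξ) * Complex.I) * (f x : ℂ)‖ := by
  have hfi : Integrable (fun x => f x) := f.continuous.integrable_of_hasCompactSupport
    f.hasCompactSupport
  have hint : Integrable
      (fun x => Complex.exp (↑(-2 * Real.pi * inner ℝ x ξ) * Complex.I) * (f x : ℂ)) := by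
    refine (hfi.ofReal (𝕜 := ℂ)).bdd_mul (c := 1)
      (Continuous.aestronglyMeasurable (by fun_prop)) ?_
    exact Eventually.of_forall fun x => (Complex.norm_exp_ofReal_mul_I _).le
  have hre : ∀ x, (Complex.exp (↑(-2 * Real.pi * inner ℝ x ξ) * Complex.I) * (f x : ℂ)).re =
      Real.cos (-2 * Real.pi * inner ℝ x ξ) * f x := fun x => by
    rw [Complex.re_mul_ofReal, Complex.exp_ofReal_mul_I_re]
  refine le_trans ?_ (Complex.re_le_norm _)
  have h1 := integral_re hint
  simp only [RCLike.re_to_complex, hre] at h1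
  rw [← h1, ← integral_const_mul]
  refine integral_mono (hfi.const_mul _) (by simpa only [RCLike.re_to_complex, hre] using hint.re)
    fun x => ?_
  by_cases hx : f x = 0
  · simp [hx]
  have hx' : ‖x‖ ≤ 1 / 4 := by
    have : x ∈ Metric.ball 0 f.rOut := by rw [← f.support_eq]; exact hx
    exact (mem_ball_zero_iff.1 this).le.trans hf
  refine mul_le_mul_of_nonneg_right ?_ f.nonneg
  have h2 : |-2 * Real.pi * inner ℝ x ξ| ≤ 1 / 4 := by
    rw [abs_mul, abs_mul, abs_neg, abs_two, abs_of_pos Real.pi_pos]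
    calc 2 * Real.pi * |inner ℝ x ξ| ≤ 2 * Real.pi * (‖x‖ * ‖ξ‖) := by
          gcongr; exact abs_real_inner_le_norm x ξ
      _ ≤ 2 * Real.pi * (1 / 4 * (2 * Real.pi)⁻¹) := by gcongr
      _ = 1 / 4 := by field_simp
  rw [← Real.cos_abs (-2 * _ * _)]
  apply Real.cos_le_cos_of_nonneg_of_le_pi (abs_nonneg _) _ h2
  linarith [Real.pi_gt_three]

lemma integral_sq_sum_translate {ι : Type*} (f : ContDiffBump (0 : EuclideanSpace ℝ (Fin d)))
    (hf : f.rOut ≤ 1 / 4) (s : Finset ι) (y : ι → EuclideanSpace ℝ (Fin d))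
    (hy : ∀ i ∈ s, ∀ j ∈ s, i ≠ j → 1 ≤ dist (y i) (y j)) :
    ∫ x, (∑ i ∈ s, f (x + y i)) ^ 2 = s.card * ∫ x, f x ^ 2 := by
  have h : ∀ x, (∑ i ∈ s, f (x + y i)) ^ 2 = ∑ i ∈ s, f (x + y i) ^ 2 := fun x => by
    refine sum_sq_eq_of_mul_eq_zero s _ fun i hi j hj hij => ?_
    by_contra hne
    have hball : ∀ k, f (x + y k) ≠ 0 → ‖x + y k‖ < 1 / 4 := fun k hk => by
      have : x + y k ∈ Metric.ball 0 f.rOut := by rw [← f.support_eq]; exact hk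
      exact (mem_ball_zero_iff.1 this).trans_le hf
    have h1 := hball i (left_ne_zero_of_mul hne)
    have h2 := hball j (right_ne_zero_of_mul hne)
    have h3 := hy i hi j hj hij
    have h4 : dist (y i) (y j) ≤ ‖x + y i‖ + ‖x + y j‖ := by
      rw [dist_eq_norm, show y i - y j = (x + y i) - (x + y j) by abel]
      exact norm_sub_le _ _
    linarith
  simp only [h]
  have hfi : Integrable (fun x => f x ^ 2) := by
    refine (f.continuous.pow 2).integrable_of_hasCompactSupport ?_
    simpa [sq] using f.hasCompactSupport.mul_left (f := fun x => f x)
  rw [integral_finsetSum s fun i _ => hfi.comp_add_right (y i)]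
  simp only [integral_add_right_eq_self (fun x => f x ^ 2)]
  simp

/-- The exponential sum times `f̂` is the transform of a sum of translated bumps. By disjointness of
supports and Plancherel its squared `L²` norm is the number of points times that of `f`, while
`|f̂|` is bounded below on the small ball. -/
lemma integral_norm_sq_expSum_le {ι : Type*} (f : ContDiffBump (0 : EuclideanSpace ℝ (Fin d)))
    (hf : f.rOut ≤ 1 / 4) (s : Finset ι) (y : ι → EuclideanSpace ℝ (Fin d))
    (hy : ∀ i ∈ s, ∀ j ∈ s, i ≠ j → 1 ≤ dist (y i) (y j)) :
    (Real.cos (1 / 4) * ∫ x, f x) ^ 2 *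
      ∫ ξ in Metric.closedBall (0 : EuclideanSpace ℝ (Fin d)) (2 * Real.pi)⁻¹,
        ‖∑ i ∈ s, Complex.exp (↑(2 * Real.pi * inner ℝ (y i) ξ) * Complex.I)‖ ^ 2 ≤
      s.card * ∫ x, f x ^ 2 := by
  set h : EuclideanSpace ℝ (Fin d) → ℂ := fun x => (f x : ℂ) with hh
  have hsupp : HasCompactSupport h := f.hasCompactSupport.comp_left Complex.ofReal_zero
  have hsmooth : ContDiff ℝ (⊤ : ℕ∞) h := Complex.ofRealCLM.contDiff.comp f.contDiff
  have hint : ∀ ξ, Integrable fun x =>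
      Complex.exp (↑(-2 * Real.pi * inner ℝ x ξ) * Complex.I) * h x := fun ξ => by
    refine (hsmooth.continuous.integrable_of_hasCompactSupport hsupp).bdd_mul (c := 1)
      (Continuous.aestronglyMeasurable (by fun_prop)) ?_
    exact Eventually.of_forall fun x => (Complex.norm_exp_ofReal_mul_I _).le
  let H := hsupp.toSchwartzMap hsmooth
  let g : SchwartzMap (EuclideanSpace ℝ (Fin d)) ℂ := ∑ i ∈ s,
    SchwartzMap.compSubConstCLM ℂ (-(y i)) H
  have hg : ∀ x, g x = ((∑ i ∈ s, f (x + y i) : ℝ) : ℂ) := fun x => by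
    simp [g, H, hh]
  have hF : ∀ ξ, FourierTransform.fourier (g : EuclideanSpace ℝ (Fin d) → ℂ) ξ =
      (∑ i ∈ s, Complex.exp (↑(2 * Real.pi * inner ℝ (y i) ξ) * Complex.I)) *
        ∫ x, Complex.exp (↑(-2 * Real.pi * inner ℝ x ξ) * Complex.I) * (f x : ℂ) := fun ξ => by
    have hshift : ∀ i x, Complex.exp (↑(-2 * Real.pi * inner ℝ x ξ) * Complex.I) * h (x + y i) =
        Complex.exp (↑(2 * Real.pi * inner ℝ (y i) ξ) * Complex.I) *
        (Complex.exp (↑(-2 * Real.pi * inner ℝ (x + y i) ξ) * Complex.I) * h (x + y i)) :=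
      fun i x => by
        rw [← mul_assoc, ← Complex.exp_add, inner_add_left]
        congr 2
        push_cast
        ring
    rw [Real.fourier_eq']
    have : ∀ x, Complex.exp (↑(-2 * Real.pi * inner ℝ x ξ) * Complex.I) • g x =
        ∑ i ∈ s, Complex.exp (↑(2 * Real.pi * inner ℝ (y i) ξ) * Complex.I) *
        (Complex.exp (↑(-2 * Real.pi * inner ℝ (x + y i) ξ) * Complex.I) * h (x + y i)) :=
      fun x => by
        rw [hg, smul_eq_mul, Complex.ofReal_sum, Finset.mul_sum]
        exact Finset.sum_congr rfl fun i _ => hshift i x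
    simp only [this]
    rw [integral_finsetSum s fun i _ => ((hint ξ).comp_add_right (y i)).const_mul _,
      Finset.sum_mul]
    refine Finset.sum_congr rfl fun i _ => ?_
    rw [integral_const_mul, integral_add_right_eq_self
      (fun x => Complex.exp (↑(-2 * Real.pi * inner ℝ x ξ) * Complex.I) * h x)]
  have hP := SchwartzMap.integral_norm_sq_fourier g
  have hr : ∫ x, ‖g x‖ ^ 2 = s.card * ∫ x, f x ^ 2 := by
    rw [← integral_sq_sum_translate f hf s y hy]
    refine integral_congr_ae (Eventually.of_forall fun x => ?_)
    simp only [hg, Complex.norm_real, Real.norm_eq_abs, sq_abs]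
  rw [← hr, ← hP, ← integral_const_mul]
  have hcont : Continuous fun ξ : EuclideanSpace ℝ (Fin d) =>
      ‖∑ i ∈ s, Complex.exp (↑(2 * Real.pi * inner ℝ (y i) ξ) * Complex.I)‖ ^ 2 := by fun_prop
  have hFi : Integrable fun ξ => ‖(FourierTransform.fourier g) ξ‖ ^ 2 :=
    ((FourierTransform.fourier g).memLp 2).integrable_norm_pow (by norm_num)
  refine le_trans ?_ (setIntegral_le_integral (s := Metric.closedBall 0 (2 * Real.pi)⁻¹) hFi
    (Eventually.of_forall fun ξ => by positivity))
  refine setIntegral_mono_on ?_ hFi.integrableOn Metric.isClosed_closedBall.measurableSet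
    fun ξ hξ => ?_
  · exact ((continuous_const.mul hcont).continuousOn).integrableOn_compact
      (isCompact_closedBall _ _)
  · rw [SchwartzMap.fourier_coe, hF, norm_mul, mul_comm ‖_‖ ‖_‖, mul_pow ‖_‖]
    refine mul_le_mul_of_nonneg_right (pow_le_pow_left₀ ?_ ?_ 2) (by positivity)
    · exact mul_nonneg (Real.cos_pos_of_mem_Ioo
        ⟨by linarith [Real.pi_gt_three], by linarith [Real.pi_gt_three]⟩).le
        (integral_nonneg fun x => f.nonneg)
    · exact le_norm_fourier_bump f hf (by simpa using hξ)

lemma exists_expSum_bound (d : ℕ) : ∃ C : ℝ, 0 < C ∧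
    ∀ (X : Finset (EuclideanSpace ℝ (Fin d))) (R : ℝ), 0 < R →
      (∀ x ∈ X, ∀ y ∈ X, x ≠ y → R⁻¹ ≤ dist x y) →
      (R ^ d)⁻¹ * ∫ z in Metric.closedBall (0 : EuclideanSpace ℝ (Fin d)) R,
        ‖∑ x ∈ X, Complex.exp (inner ℝ x z * Complex.I)‖ ^ 2 ≤ C * X.card := by
  let f : ContDiffBump (0 : EuclideanSpace ℝ (Fin d)) := ⟨1 / 8, 1 / 4, by norm_num, by norm_num⟩
  set c := Real.cos (1 / 4) * ∫ x, f x
  have hc : 0 < c := mul_pos (Real.cos_pos_of_mem_Ioo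
    ⟨by linarith [Real.pi_gt_three], by linarith [Real.pi_gt_three]⟩) f.integral_pos
  have hI : 0 ≤ ∫ x, f x ^ 2 := integral_nonneg fun x => by positivity
  -- The `+ 1` makes the constant positive without showing `∫ f² > 0`.
  refine ⟨(2 * Real.pi) ^ d * ((∫ x, f x ^ 2) / c ^ 2) + 1, by positivity, fun X R hR hX => ?_⟩
  have hpi := Real.pi_pos
  have h1 := integral_norm_sq_expSum_le f le_rfl X (fun x => R • x) (fun x hx y hy hxy => by
    rw [dist_smul₀, Real.norm_of_nonneg hR.le]
    have := hX x hx y hy hxy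
    rwa [inv_le_iff_one_le_mul₀' hR] at this)
  have h2 := Measure.setIntegral_comp_smul_of_pos
    (volume : Measure (EuclideanSpace ℝ (Fin d)))
    -- Dilating frequencies by `2πR` maps the ball of radius `1/(2π)` to that of radius `R` and
    -- makes the points `R • x` 1-separated.
    (fun z => ‖∑ x ∈ X, Complex.exp (inner ℝ x z * Complex.I)‖ ^ 2)
    (Metric.closedBall 0 (2 * Real.pi)⁻¹) (R := 2 * Real.pi * R) (by positivity)
  rw [smul_closedBall _ _ (by positivity), smul_zero, Real.norm_of_nonneg (by positivity),
    show 2 * Real.pi * R * (2 * Real.pi)⁻¹ = R by field_simp, finrank_euclideanSpace_fin] at h2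
  have h3 : ∀ ξ x : EuclideanSpace ℝ (Fin d),
      inner ℝ x ((2 * Real.pi * R) • ξ) = 2 * Real.pi * inner ℝ (R • x) ξ := fun ξ x => by
    rw [inner_smul_right, real_inner_smul_left]; ring
  simp only [h3] at h2
  rw [h2, smul_eq_mul] at h1
  set J := ∫ z in Metric.closedBall (0 : EuclideanSpace ℝ (Fin d)) R,
        ‖∑ x ∈ X, Complex.exp (inner ℝ x z * Complex.I)‖ ^ 2
  have h4 : (R ^ d)⁻¹ * J ≤ (2 * Real.pi) ^ d * ((∫ x, f x ^ 2) / c ^ 2) * X.card := by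
    have h5 : (R ^ d)⁻¹ * J = (2 * Real.pi) ^ d / c ^ 2 *
        (c ^ 2 * (((2 * Real.pi * R) ^ d)⁻¹ * J)) := by
      rw [mul_pow (2 * Real.pi)]; field_simp
    rw [h5]
    calc _ ≤ (2 * Real.pi) ^ d / c ^ 2 * (X.card * ∫ x, f x ^ 2) := by gcongr
      _ = _ := by ring
  nlinarith [(Nat.cast_nonneg X.card : (0 : ℝ) ≤ X.card)]

lemma exists_separated_finset {A : Set (EuclideanSpace ℝ (Fin d))} (hA : A.Nonempty) {r : ℝ}
    (hr : 0 < r) : ∃ X : Finset (EuclideanSpace ℝ (Fin d)), X.Nonempty ∧ ↑X ⊆ A ∧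
      (∀ x ∈ X, ∀ y ∈ X, x ≠ y → r ≤ dist x y) ∧ coverNum (2 * r) A ≤ X.card := by
  classical
  -- The negated goal itself bounds the size of separated subsets, so one of maximal size exists;
  -- the closed `r`-balls about its points then cover `A`.
  by_contra! hcon
  set S : Set ℕ := {n | ∃ X : Finset (EuclideanSpace ℝ (Fin d)), X.Nonempty ∧ ↑X ⊆ A ∧
      (∀ x ∈ X, ∀ y ∈ X, x ≠ y → r ≤ dist x y) ∧ X.card = n}
  obtain ⟨a, ha⟩ := hA
  have hS : S.Nonempty := ⟨1, {a}, by simp, by simpa using ha, by simp, by simp⟩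
  have hbdd : BddAbove S := by
    refine ⟨coverNum (2 * r) A, ?_⟩
    rintro n ⟨X, h1, h2, h3, rfl⟩
    exact (hcon X h1 h2 h3).le
  obtain ⟨X, h1, h2, h3, h4⟩ := Nat.sSup_mem hS hbdd
  refine (hcon X h1 h2 h3).not_ge (Nat.sInf_le
    ⟨fun i => Metric.closedBall (X.equivFin.symm i : EuclideanSpace ℝ (Fin d)) r,
      fun i => ?_, fun x hx => ?_⟩)
  · beta_reduce
    rw [← Metric.closedEBall_ofReal hr.le, ENNReal.ofReal_mul two_pos.le, ENNReal.ofReal_ofNat]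
    exact Metric.ediam_closedEBall_le
  · by_contra hn
    have hfar : ∀ y ∈ X, r < dist x y := fun y hy => by
      by_contra! hle
      exact hn (mem_iUnion.2 ⟨X.equivFin ⟨y, hy⟩, by simpa using hle⟩)
    have hxX : x ∉ X := fun hxX => by simpa using (hr.trans (hfar x hxX)).ne'
    have : X.card + 1 ≤ sSup S := by
      refine le_csSup hbdd ⟨insert x X, by simp, ?_, ?_, Finset.card_insert_of_notMem hxX⟩
      · rw [Finset.coe_insert]
        exact insert_subset hx h2
      · intro u hu v hv huv
        rcases Finset.mem_insert.1 hu with hu' | hu' <;>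
          rcases Finset.mem_insert.1 hv with hv' | hv'
        · exact absurd (hu'.trans hv'.symm) huv
        · exact hu' ▸ (hfar v hv').le
        · rw [dist_comm]; exact hv' ▸ (hfar u hu').le
        · exact h3 u hu' v hv' huv
    omega

/-! ### The Fourier side is at most the dimension -/

lemma energy_pos_of_isCompact (μ : Measure (EuclideanSpace ℝ (Fin d))) [IsProbabilityMeasure μ]
    {A : Set (EuclideanSpace ℝ (Fin d))} (hA : IsCompact A) (hμ : 0 < μ.real A) {R : ℝ}
    (hR : 0 < R) : 0 < energy μ R := by
  have h := (mul_pos (lowerConst_pos d) (pow_pos hμ 2)).trans_le (energy_ge_coverNum μ hA hR)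
  exact pos_of_mul_pos_right h (Nat.cast_nonneg _)

lemma limsup_fourierExponent_le (μ : Measure (EuclideanSpace ℝ (Fin d))) [IsProbabilityMeasure μ]
    {A : Set (EuclideanSpace ℝ (Fin d))} (hA : IsCompact A) (hμ : 0 < μ.real A) {a : ℝ}
    {R : ℕ → ℝ} (hR : Tendsto R atTop atTop)
    (h : ∀ k, Real.log (coverNum (R k)⁻¹ A) / (-Real.log (R k)⁻¹) ≤ a) :
    limsup (fun k => ((fourierExponent μ (R k) : ℝ) : EReal)) atTop ≤ a := by
  set m := lowerConst d * μ.real A ^ 2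
  have hm : 0 < m := mul_pos (lowerConst_pos d) (pow_pos hμ 2)
  have hlog : Tendsto (fun k => Real.log (R k)) atTop atTop := Real.tendsto_log_atTop.comp hR
  -- The multiplicative constant `m` disappears after division by `log (R k)`.
  have hlim : Tendsto (fun k => ((a - Real.log m / Real.log (R k) : ℝ) : EReal)) atTop
      (𝓝 (a : EReal)) := by
    refine (continuous_coe_real_ereal.tendsto a).comp ?_
    simpa using tendsto_const_nhds.sub (hlog.const_div_atTop (Real.log m))
  rw [← hlim.limsup_eq]
  refine limsup_le_limsup ?_
  filter_upwards [hR.eventually_gt_atTop 1] with k hk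
  rw [EReal.coe_le_coe_iff]
  have hR0 : 0 < R k := one_pos.trans hk
  have hl : 0 < Real.log (R k) := Real.log_pos hk
  have h1 := energy_ge_coverNum μ hA hR0
  have hE := energy_pos_of_isCompact μ hA hμ hR0
  have hN : (0 : ℝ) < coverNum (R k)⁻¹ A := pos_of_mul_pos_left (hm.trans_le h1) hE.le
  have h2 := h k
  rw [Real.log_inv, neg_neg, div_le_iff₀ hl] at h2
  have h3 := Real.log_le_log hm h1
  rw [Real.log_mul hN.ne' hE.ne'] at h3
  rw [fourierExponent_eq, div_neg, ← neg_div, div_le_iff₀ hl, sub_mul, div_mul_cancel₀ _ hl.ne']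
  linarith

/-- Baire in the compact space `F`. The index precedes `μ`, which is what lets the radii be fixed
before the measure. -/
lemma exists_forall_measure_pos {F : Set (EuclideanSpace ℝ (Fin d))} (hF : IsCompact F)
    (hne : F.Nonempty) {C : ℕ → Set (EuclideanSpace ℝ (Fin d))} (hC : ∀ i, IsCompact (C i))
    (hFC : F ⊆ ⋃ i, C i) :
    ∃ i, ∀ μ : Measure (EuclideanSpace ℝ (Fin d)), μ.support = F → 0 < μ (C i) := by
  have : CompactSpace F := isCompact_iff_compactSpace.1 hF
  have : Nonempty F := hne.to_subtype
  obtain ⟨i, x, hx⟩ := nonempty_interior_of_iUnion_of_closed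
    (f := fun i => ((↑) : F → EuclideanSpace ℝ (Fin d)) ⁻¹' C i)
    (fun i => (hC i).isClosed.preimage continuous_subtype_val)
    (by rw [← preimage_iUnion]; exact eq_univ_of_forall fun x => hFC x.2)
  obtain ⟨U, hU, hUC⟩ := mem_nhds_induced _ _ _ |>.1 (mem_interior_iff_mem_nhds.1 hx)
  refine ⟨i, fun μ hμ => ?_⟩
  have hxs : (x : EuclideanSpace ℝ (Fin d)) ∈ μ.support := hμ ▸ x.2
  have hUpos : 0 < μ U := (Measure.mem_support_iff_forall _).1 hxs U hU
  have hae : μ U = μ (U ∩ F) := by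
    refine (measure_inter_conull ?_).symm
    rw [← hμ]
    exact Measure.measure_compl_support
  rw [hae] at hUpos
  exact hUpos.trans_le (measure_mono fun y hy => hUC (a := ⟨y, hy.2⟩) hy.1)

theorem iSup_le_modLowerBoxDim (E : Set (EuclideanSpace ℝ (Fin d))) (hE : IsCompact E) :
    (⨆ (F : Set (EuclideanSpace ℝ (Fin d))) (_ : F ⊆ E),
        ⨅ (R : ℕ → ℝ) (_ : Monotone R ∧ Tendsto R atTop atTop),
          ⨆ (μ : Measure (EuclideanSpace ℝ (Fin d)))
            (_ : IsProbabilityMeasure μ ∧ μ.support = F),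
            limsup (fun k : ℕ => ((fourierExponent μ (R k) : ℝ) : EReal)) atTop) ≤
      modLowerBoxDim E := by
  refine iSup₂_le fun F hF => le_iInf₂ fun C hC => ?_
  by_cases hex : ∃ μ : Measure (EuclideanSpace ℝ (Fin d)), IsProbabilityMeasure μ ∧ μ.support = F
  swap
  · refine iInf₂_le_of_le (fun n : ℕ => (n : ℝ)) ⟨Nat.mono_cast, tendsto_natCast_atTop_atTop⟩ ?_
    exact iSup₂_le fun μ hμ => absurd ⟨μ, hμ⟩ hex
  have hFE : F ⊆ ⋃ i, C i := hF.trans hC.2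
  obtain ⟨μ₀, hμ₀, hs⟩ := hex
  have hFc : IsCompact F := hE.of_isClosed_subset (hs ▸ Measure.isClosed_support) hF
  have hFn : F.Nonempty := hs ▸ Measure.nonempty_support (IsProbabilityMeasure.ne_zero μ₀)
  obtain ⟨i, hi⟩ := exists_forall_measure_pos hFc hFn (fun i => (hC.1 i).1) hFE
  refine le_trans ?_ (le_iSup (fun i => lowerBoxDim (C i)) i)
  refine EReal.le_of_forall_lt_iff_le.1 fun a ha => ?_
  obtain ⟨r, hr, hra⟩ := exists_seq_forall_of_frequently (frequently_lt_of_liminf_lt (by isBoundedDefault) ha)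
  have hinv : Tendsto (fun k => (r k)⁻¹) atTop atTop := tendsto_inv_nhdsGT_zero.comp hr
  -- Passing to a subsequence makes the radii monotone.
  obtain ⟨φ, hφ, hmono⟩ := strictMono_subseq_of_tendsto_atTop hinv
  refine iInf₂_le_of_le _ ⟨hmono.monotone, hinv.comp hφ.tendsto_atTop⟩ ?_
  refine iSup₂_le fun μ hμ => ?_
  have := hμ.1
  refine limsup_fourierExponent_le μ (hC.1 i).1
    (ENNReal.toReal_pos (hi μ hμ.2).ne' (measure_ne_top _ _)) (hinv.comp hφ.tendsto_atTop)
    fun k => ?_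
  simpa using (EReal.coe_lt_coe_iff.1 (hra (φ k))).le

/-! ### Mixtures and generic measures in the weak topology -/

section Mixture

open scoped NNReal

variable {Ω ι : Type*} [MeasurableSpace Ω]

/-- The finite convex combination `∑ w i • ν i` of probability measures. -/
noncomputable def mixture (s : Finset ι) (w : ι → ℝ≥0) (ν : ι → ProbabilityMeasure Ω)
    (hw : ∑ i ∈ s, w i = 1) : ProbabilityMeasure Ω :=
  ⟨∑ i ∈ s, w i • (ν i : Measure Ω), ⟨by
    simp only [Measure.coe_finsetSum, Finset.sum_apply, Measure.smul_apply, measure_univ]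
    simp only [ENNReal.smul_def, smul_eq_mul, mul_one]
    exact_mod_cast hw⟩⟩

lemma mixture_toMeasure (s : Finset ι) (w : ι → ℝ≥0) (ν : ι → ProbabilityMeasure Ω)
    (hw : ∑ i ∈ s, w i = 1) :
    (mixture s w ν hw : Measure Ω) = ∑ i ∈ s, w i • (ν i : Measure Ω) := rfl

lemma integral_mixture {G : Type*} [NormedAddCommGroup G] [NormedSpace ℝ G] (s : Finset ι)
    (w : ι → ℝ≥0) (ν : ι → ProbabilityMeasure Ω) (hw : ∑ i ∈ s, w i = 1) {f : Ω → G}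
    (hf : ∀ i ∈ s, Integrable f (ν i : Measure Ω)) :
    ∫ x, f x ∂(mixture s w ν hw : Measure Ω) =
      ∑ i ∈ s, (w i : ℝ) • ∫ x, f x ∂(ν i : Measure Ω) := by
  rw [mixture_toMeasure, integral_finsetSum_measure fun i hi => (hf i hi).smul_measure_nnreal]
  exact Finset.sum_congr rfl fun i _ => integral_smul_nnreal_measure _ _

end Mixture

section WeakTopology

open scoped NNReal

variable {Ω : Type*} [MetricSpace Ω] [CompactSpace Ω] [MeasurableSpace Ω] [BorelSpace Ω]

lemma integrable_of_continuous_compactSpace {G : Type*} [NormedAddCommGroup G]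
    (μ : Measure Ω) [IsFiniteMeasure μ] {f : Ω → G} (hf : Continuous f) : Integrable f μ := by
  simpa using hf.continuousOn.integrableOn_compact (μ := μ) isCompact_univ

/-- A set of probability measures is dense as soon as it contains all mixtures of suitable
probability measures concentrated near prescribed points. -/
lemma dense_of_forall_mixture_mem (S : Set (ProbabilityMeasure Ω))
    (hS : ∀ (Y : Finset Ω) (ε : ℝ), 0 < ε → ∃ ν : Ω → ProbabilityMeasure Ω,
      (∀ y ∈ Y, (ν y : Measure Ω) (Metric.closedBall y ε)ᶜ = 0) ∧
      ∀ (w : Ω → ℝ≥0) (hw : ∑ y ∈ Y, w y = 1), mixture Y w ν hw ∈ S) : Dense S := by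
  intro μ
  obtain ⟨y₀⟩ := μ.nonempty
  -- Discretise the identity by simple functions and weight each value by the `μ`-mass of its fibre.
  -- The mixture then integrates `f` as `x ↦ ∫ f dν_{s n x}` against `μ`, and dominated convergence
  -- applies.
  let s : ℕ → SimpleFunc Ω Ω := fun n => SimpleFunc.approxOn id measurable_id univ y₀ (mem_univ _) n
  have hs : ∀ x, Tendsto (fun n => s n x) atTop (𝓝 x) := fun x =>
    SimpleFunc.tendsto_approxOn measurable_id (mem_univ y₀) (by simp)
  have hε : ∀ n : ℕ, (0 : ℝ) < 1 / (n + 1) := fun n => Nat.one_div_pos_of_nat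
  choose ν hν hmem using fun n : ℕ => hS (s n).range _ (hε n)
  let w : ℕ → Ω → ℝ≥0 := fun n y => μ (s n ⁻¹' {y})
  have hsum : ∀ (n : ℕ) (g : Ω → ℝ), ∑ y ∈ (s n).range, (w n y : ℝ) • g y =
      ∫ x, g (s n x) ∂(μ : Measure Ω) := fun n g => by
    have h1 : ∀ x, g (s n x) =
        ∑ y ∈ (s n).range, (s n ⁻¹' {y}).indicator (fun _ => g y) x := fun x => by
      rw [Finset.sum_eq_single (s n x)]
      · simp
      · intro y _ hy
        exact indicator_of_notMem (fun h => hy (by simpa using h.symm)) _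
      · intro h
        exact absurd (SimpleFunc.mem_range_self _ x) h
    simp only [h1]
    rw [integral_finsetSum _ fun y _ =>
      (integrable_const (g y)).indicator ((s n).measurableSet_fiber y)]
    refine Finset.sum_congr rfl fun y _ => ?_
    rw [integral_indicator_const _ ((s n).measurableSet_fiber y)]
    rfl
  have hw : ∀ n, ∑ y ∈ (s n).range, w n y = 1 := fun n => by
    have := hsum n fun _ => 1
    simp only [smul_eq_mul, mul_one, integral_const, probReal_univ] at this
    exact_mod_cast this
  refine mem_closure_of_tendsto (b := atTop) (f := fun n => mixture (s n).range (w n) (ν n) (hw n)) ?_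
    (Eventually.of_forall fun n => hmem n (w n) (hw n))
  rw [ProbabilityMeasure.tendsto_iff_forall_integral_tendsto]
  intro f
  have hfi : ∀ η : ProbabilityMeasure Ω, Integrable f (η : Measure Ω) := fun η =>
    integrable_of_continuous_compactSpace _ f.continuous
  have hint : ∀ n, ∫ x, f x ∂(mixture (s n).range (w n) (ν n) (hw n) : Measure Ω) =
      ∫ x, (∫ u, f u ∂(ν n (s n x) : Measure Ω)) ∂(μ : Measure Ω) := fun n => by
    rw [integral_mixture _ _ _ _ fun i _ => hfi _]
    exact hsum n fun y => ∫ u, f u ∂(ν n y : Measure Ω)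
  simp only [hint]
  refine tendsto_integral_of_dominated_convergence (fun _ => ‖f‖) (fun n => ?_)
    (integrable_const _) (fun n => ?_) ?_
  · exact ((s n).map fun y => ∫ u, f u ∂(ν n y : Measure Ω)).aestronglyMeasurable
  · refine Eventually.of_forall fun x => ?_
    simpa using norm_integral_le_of_norm_le_const (μ := (ν n (s n x) : Measure Ω))
      (Eventually.of_forall fun u => f.norm_coe_le_norm u)
  · refine Eventually.of_forall fun x => Metric.tendsto_nhds.2 fun δ hδ => ?_
    obtain ⟨η, hη, hf⟩ := Metric.continuousAt_iff.1 f.continuous.continuousAt (δ / 2) (half_pos hδ)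
    filter_upwards [Metric.tendsto_nhds.1 (hs x) (η / 2) (half_pos hη),
      tendsto_one_div_add_atTop_nhds_zero_nat.eventually_lt_const (half_pos hη)] with n h1 h2
    have h3 : ∀ᵐ u ∂(ν n (s n x) : Measure Ω), ‖f u - f x‖ ≤ δ / 2 := by
      refine measure_mono_null (fun u hu => ?_) (hν n (s n x) (SimpleFunc.mem_range_self _ x))
      contrapose! hu
      have hu' : dist u (s n x) ≤ 1 / (n + 1) := by simpa using hu
      have : dist u x < η := by linarith [dist_triangle u (s n x) x]
      simpa [dist_eq_norm] using (hf this).le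
    have h4 := norm_integral_le_of_norm_le_const h3
    rw [integral_sub (hfi _) (integrable_const _)] at h4
    simp only [integral_const, probReal_univ, one_smul, mul_one] at h4
    rw [dist_eq_norm]
    linarith

lemma isOpen_setOf_integral_pos {f : Ω → ℝ} (hf : Continuous f) :
    IsOpen {μ : ProbabilityMeasure Ω | 0 < ∫ x, f x ∂(μ : Measure Ω)} :=
  isOpen_lt continuous_const
    (ProbabilityMeasure.continuous_integral_continuousMap (⟨f, hf⟩ : C(Ω, ℝ)))

/-- Moving a vanishing fraction of the mass to `x₀` makes the integral positive and perturbs `μ`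
weakly little. -/
lemma dense_setOf_integral_pos {f : Ω → ℝ} (hf : Continuous f) (hf0 : ∀ x, 0 ≤ f x) {x₀ : Ω}
    (hx₀ : 0 < f x₀) : Dense {μ : ProbabilityMeasure Ω | 0 < ∫ x, f x ∂(μ : Measure Ω)} := by
  intro μ
  let ε : ℕ → ℝ≥0 := fun n => ((n : ℝ≥0) + 1)⁻¹
  have hε1 : ∀ n, ε n ≤ 1 := fun n => inv_le_one_of_one_le₀ (by simp)
  have hε0 : ∀ n, 0 < ε n := fun n => by positivity
  have hεlim : Tendsto (fun n => (ε n : ℝ)) atTop (𝓝 0) := by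
    simpa [ε] using tendsto_one_div_add_atTop_nhds_zero_nat (𝕜 := ℝ)
  let δ : ProbabilityMeasure Ω := diracProba x₀
  have hw : ∀ n, ∑ b : Bool, (bif b then ε n else 1 - ε n) = 1 := fun n => by
    simpa using add_tsub_cancel_of_le (hε1 n)
  have key : ∀ n (g : Ω → ℝ), Continuous g →
      ∫ x, g x ∂(mixture Finset.univ _ (fun b : Bool => bif b then δ else μ) (hw n) : Measure Ω) =
        ε n * g x₀ + (1 - ε n) * ∫ x, g x ∂(μ : Measure Ω) := fun n g hg => by
    rw [integral_mixture _ _ _ _ fun b _ => integrable_of_continuous_compactSpace _ hg]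
    rw [Fintype.sum_bool]
    change (ε n : ℝ) * ∫ x, g x ∂(Measure.dirac x₀) +
      ((1 - ε n : ℝ≥0) : ℝ) * ∫ x, g x ∂(μ : Measure Ω) = _
    rw [integral_dirac, NNReal.coe_sub (hε1 n), NNReal.coe_one]
  refine mem_closure_of_tendsto (b := atTop)
    (f := fun n : ℕ => mixture Finset.univ _ (fun b : Bool => bif b then δ else μ) (hw n)) ?_
    (Eventually.of_forall fun n => ?_)
  · rw [ProbabilityMeasure.tendsto_iff_forall_integral_tendsto]
    intro g
    simp only [key _ g g.continuous]
    simpa using (hεlim.mul_const (g x₀)).add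
      ((hεlim.const_sub 1).mul_const (∫ x, g x ∂(μ : Measure Ω)))
  · change 0 < ∫ x, f x ∂_
    rw [key n f hf]
    have h1 : (0 : ℝ) < ε n := hε0 n
    have h2 : (ε n : ℝ) ≤ 1 := hε1 n
    have h3 : 0 ≤ ∫ x, f x ∂(μ : Measure Ω) := integral_nonneg hf0
    have := mul_pos h1 hx₀
    have := mul_nonneg (sub_nonneg.2 h2) h3
    linarith

/-- A residual set of probability measures on a compact metric space contains one of full
support. -/
lemma exists_mem_iInter_forall_ball_pos [Nonempty Ω] (G : ℕ → Set (ProbabilityMeasure Ω))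
    (hGo : ∀ n, IsOpen (G n)) (hGd : ∀ n, Dense (G n)) :
    ∃ μ : ProbabilityMeasure Ω, (∀ n, μ ∈ G n) ∧
      ∀ (x : Ω) (ε : ℝ), 0 < ε → 0 < (μ : Measure Ω) (Metric.ball x ε) := by
  let q := TopologicalSpace.denseSeq Ω
  -- Tent functions at a dense sequence with radii `1/(m+1)` reduce full support to countably many
  -- open dense conditions.
  let f : ℕ × ℕ → Ω → ℝ := fun p x => max 0 (1 / ((p.2 : ℝ) + 1) - dist x (q p.1))
  have hf : ∀ p, Continuous (f p) := fun p => by fun_prop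
  have hpos : ∀ p : ℕ × ℕ, (0 : ℝ) < 1 / ((p.2 : ℝ) + 1) := fun p => Nat.one_div_pos_of_nat
  have hd1 := dense_iInter_of_isOpen hGo hGd
  have hd2 := dense_iInter_of_isOpen (fun p => isOpen_setOf_integral_pos (hf p))
    (fun p => dense_setOf_integral_pos (hf p) (fun x => le_max_left _ _) (x₀ := q p.1)
      (by simpa [f] using (by positivity : (0 : ℝ) < (p.2 : ℝ) + 1)))
  have : Nonempty (ProbabilityMeasure Ω) :=
    ⟨diracProba (Classical.arbitrary Ω)⟩
  obtain ⟨μ, h1, h2⟩ := (hd1.inter_of_Gδ (IsGδ.iInter_of_isOpen hGo)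
    (IsGδ.iInter_of_isOpen fun p => isOpen_setOf_integral_pos (hf p)) hd2).nonempty
  refine ⟨μ, fun n => mem_iInter.1 h1 n, fun x ε hε => ?_⟩
  obtain ⟨m, hm⟩ := exists_nat_one_div_lt (half_pos hε)
  obtain ⟨j, hj⟩ := (TopologicalSpace.denseRange_denseSeq Ω).exists_dist_lt x (hpos (0, m))
  have h3 : 0 < ∫ u, f (j, m) u ∂(μ : Measure Ω) := mem_iInter.1 h2 (j, m)
  refine pos_iff_ne_zero.2 fun h0 => h3.ne' (integral_eq_zero_of_ae ?_)
  refine measure_mono_null (fun u hu => ?_) h0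
  contrapose! hu
  have h4 : ε ≤ dist u x := by simpa using hu
  have h5 : 1 / ((m : ℝ) + 1) - dist u (q j) ≤ 0 := by
    have := dist_triangle u (q j) x
    rw [dist_comm x] at hj
    change dist (q j) x < 1 / ((m : ℝ) + 1) at hj
    linarith
  simpa [f] using h5

end WeakTopology

open scoped NNReal


/-! ### Removing the locally small part of `E` -/

section Core

/-- `A` is covered by countably many compact sets of lower box dimension at most `s`. -/
def IsSmall (s : ℝ) (A : Set (EuclideanSpace ℝ (Fin d))) : Prop :=
  ∃ 𝒞 : Set (Set (EuclideanSpace ℝ (Fin d))), 𝒞.Countable ∧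
    (∀ C ∈ 𝒞, IsCompact C ∧ (C.Nonempty → lowerBoxDim C ≤ s)) ∧ A ⊆ ⋃₀ 𝒞

lemma IsSmall.mono {s : ℝ} {A B : Set (EuclideanSpace ℝ (Fin d))} (hB : IsSmall s B)
    (h : A ⊆ B) : IsSmall s A :=
  let ⟨𝒞, h1, h2, h3⟩ := hB
  ⟨𝒞, h1, h2, h.trans h3⟩

lemma isSmall_of_isCompact {s : ℝ} {A : Set (EuclideanSpace ℝ (Fin d))} (hA : IsCompact A)
    (h : lowerBoxDim A ≤ s) : IsSmall s A :=
  ⟨{A}, countable_singleton A, by simpa using ⟨hA, fun _ => h⟩, by simp⟩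

lemma isSmall_biUnion {ι : Type*} {s : ℝ} {t : Set ι} (ht : t.Countable)
    {A : ι → Set (EuclideanSpace ℝ (Fin d))} (h : ∀ i ∈ t, IsSmall s (A i)) :
    IsSmall s (⋃ i ∈ t, A i) := by
  choose! 𝒞 h1 h2 h3 using h
  refine ⟨⋃ i ∈ t, 𝒞 i, ht.biUnion h1, fun C hC => ?_, ?_⟩
  · obtain ⟨i, hi, hCi⟩ := mem_iUnion₂.1 hC
    exact h2 i hi C hCi
  · refine iUnion₂_subset fun i hi => (h3 i hi).trans (sUnion_subset_sUnion ?_)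
    exact subset_biUnion_of_mem (u := 𝒞) hi

lemma IsSmall.union {s : ℝ} {A B : Set (EuclideanSpace ℝ (Fin d))} (hA : IsSmall s A)
    (hB : IsSmall s B) : IsSmall s (A ∪ B) := by
  obtain ⟨𝒞, h1, h2, h3⟩ := hA
  obtain ⟨𝒟, h4, h5, h6⟩ := hB
  refine ⟨𝒞 ∪ 𝒟, h1.union h4, fun C hC => hC.elim (h2 C) (h5 C), ?_⟩
  rw [sUnion_union]
  exact union_subset_union h3 h6

/-- The definition of the dimension asks for a sequence of non-empty sets: discard empty members and
enumerate the rest, a non-empty family because `A` is. -/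
lemma IsSmall.modLowerBoxDim_le {s : ℝ} {A : Set (EuclideanSpace ℝ (Fin d))} (hA : IsSmall s A)
    (hne : A.Nonempty) : modLowerBoxDim A ≤ s := by
  obtain ⟨𝒞, h1, h2, h3⟩ := hA
  obtain ⟨𝒟, h𝒟⟩ : ∃ 𝒟, 𝒟 = {C ∈ 𝒞 | C.Nonempty} := ⟨_, rfl⟩
  have hD : A ⊆ ⋃₀ 𝒟 := fun x hx => by
    obtain ⟨C, hC, hxC⟩ := h3 hx
    exact ⟨C, h𝒟 ▸ ⟨hC, x, hxC⟩, hxC⟩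
  have hDne : 𝒟.Nonempty := by
    obtain ⟨x, hx⟩ := hne
    obtain ⟨C, hC, -⟩ := hD hx
    exact ⟨C, hC⟩
  obtain ⟨f, hf⟩ := (h1.mono (h𝒟 ▸ sep_subset _ _)).exists_eq_range hDne
  have hmem : ∀ i, f i ∈ 𝒞 ∧ (f i).Nonempty := fun i => by
    have : f i ∈ 𝒟 := hf ▸ mem_range_self i
    rwa [h𝒟] at this
  refine iInf₂_le_of_le f ⟨fun i => ⟨(h2 _ (hmem i).1).1, (hmem i).2⟩, ?_⟩
    (iSup_le fun i => (h2 _ (hmem i).1).2 (hmem i).2)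
  rwa [hf, sUnion_range] at hD

/-- A compact set of modified lower box dimension larger than `s` has a non-empty compact subset
all of whose local pieces have lower box dimension larger than `s`. -/
lemma exists_core {s : ℝ} {E : Set (EuclideanSpace ℝ (Fin d))} (hE : IsCompact E)
    (hs : ¬ IsSmall s E) : ∃ F ⊆ E, IsCompact F ∧ F.Nonempty ∧
      ∀ x ∈ F, ∀ ε > 0, (s : EReal) < lowerBoxDim (F ∩ Metric.closedBall x ε) := by
  set O := {x | ∃ ε > 0, IsSmall s (E ∩ Metric.ball x ε)}
  have hO : IsOpen O := by
    refine Metric.isOpen_iff.2 fun x ⟨ε, hε, hx⟩ => ⟨ε / 2, half_pos hε, fun y hy => ?_⟩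
    refine ⟨ε / 2, half_pos hε, hx.mono (inter_subset_inter_right _ ?_)⟩
    refine Metric.ball_subset_ball' ?_
    linarith [Metric.mem_ball.1 hy]
  have hsmall : IsSmall s (E ∩ O) := by
    have : ∀ x : EuclideanSpace ℝ (Fin d), ∃ ε : ℝ, x ∈ E ∩ O →
        0 < ε ∧ IsSmall s (E ∩ Metric.ball x ε) := fun x => by
      by_cases hx : x ∈ E ∩ O
      · obtain ⟨ε, h1, h2⟩ := hx.2
        exact ⟨ε, fun _ => ⟨h1, h2⟩⟩
      · exact ⟨0, fun h => absurd h hx⟩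
    choose ε hε using this
    obtain ⟨t, ht, htc, hcov⟩ := TopologicalSpace.countable_cover_nhdsWithin
      (s := E ∩ O) (f := fun x => Metric.ball x (ε x))
      (fun x hx => mem_nhdsWithin_of_mem_nhds (Metric.ball_mem_nhds x (hε x hx).1))
    refine (isSmall_biUnion htc fun i hi => (hε i (ht hi)).2).mono fun x hx => ?_
    obtain ⟨i, hi, hxi⟩ := mem_iUnion₂.1 (hcov hx)
    exact mem_iUnion₂.2 ⟨i, hi, hx.1, hxi⟩
  have hFc : IsCompact (E \ O) := hE.diff hO
  refine ⟨E \ O, sdiff_subset, hFc, ?_, fun x hx ε hε => ?_⟩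
  · by_contra hempty
    rw [not_nonempty_iff_eq_empty, sdiff_eq_empty] at hempty
    exact hs (hsmall.mono (subset_inter subset_rfl hempty))
  · by_contra! hle
    -- Otherwise `E` near `x` would be the small set `E ∩ O` plus one compact piece of low
    -- dimension, putting `x` in `O`.
    refine hx.2 ⟨ε, hε, (hsmall.union (isSmall_of_isCompact
      (hFc.inter_right Metric.isClosed_closedBall) hle)).mono fun y hy => ?_⟩
    by_cases hyO : y ∈ O
    · exact Or.inl ⟨hy.1, hyO⟩
    · exact Or.inr ⟨⟨hy.1, hyO⟩, Metric.ball_subset_closedBall hy.2⟩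

end Core

/-! ### Measures of small energy are generic -/

section Energy

variable {F : Set (EuclideanSpace ℝ (Fin d))}

instance isProbabilityMeasure_map_val (μ : ProbabilityMeasure F) :
    IsProbabilityMeasure ((μ : Measure F).map Subtype.val) :=
  Measure.isProbabilityMeasure_map measurable_subtype_coe.aemeasurable

lemma charFun_map_val (μ : ProbabilityMeasure F) (z : EuclideanSpace ℝ (Fin d)) :
    charFun ((μ : Measure F).map Subtype.val) z =
      ∫ x : F, Complex.exp (inner ℝ (x : EuclideanSpace ℝ (Fin d)) z * Complex.I)
        ∂(μ : Measure F) := by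
  rw [charFun_apply, integral_map measurable_subtype_coe.aemeasurable
    (Continuous.aestronglyMeasurable (by fun_prop))]

lemma continuous_charFun_map_val (z : EuclideanSpace ℝ (Fin d)) :
    Continuous fun μ : ProbabilityMeasure F => charFun ((μ : Measure F).map Subtype.val) z := by
  simp only [charFun_map_val]
  refine continuous_iff_continuousAt.2 fun μ => ?_
  have := (ProbabilityMeasure.tendsto_iff_forall_integral_rclike_tendsto ℂ
    (F := 𝓝 μ) (μs := id) (μ := μ)).1 tendsto_id
  refine this (BoundedContinuousFunction.ofNormedAddCommGroup
    (fun x : F => Complex.exp (inner ℝ (x : EuclideanSpace ℝ (Fin d)) z * Complex.I))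
    (by fun_prop) 1 fun x => ?_)
  exact (Complex.norm_exp_ofReal_mul_I _).le

lemma continuous_energy_map_val (R : ℝ) :
    Continuous fun μ : ProbabilityMeasure F => energy ((μ : Measure F).map Subtype.val) R := by
  refine continuous_const.mul (continuous_of_dominated (bound := fun _ => 1) (fun μ => ?_)
    (fun μ => ?_) ?_ ?_)
  · exact ((measurable_charFun
      (μ := (μ : Measure F).map Subtype.val)).norm.pow_const 2).aestronglyMeasurable
  · refine Eventually.of_forall fun z => ?_
    simpa using pow_le_one₀ (n := 2) (norm_nonneg _)
      (norm_charFun_le_one (μ := (μ : Measure F).map Subtype.val) z)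
  · exact integrableOn_const measure_closedBall_lt_top.ne
  · exact Eventually.of_forall fun z => (continuous_charFun_map_val z).norm.pow 2

lemma charFun_mixture [CompactSpace F] {ι : Type*} (s : Finset ι) (w : ι → ℝ≥0)
    (ν : ι → ProbabilityMeasure F) (hw : ∑ i ∈ s, w i = 1) (z : EuclideanSpace ℝ (Fin d)) :
    charFun ((mixture s w ν hw : Measure F).map Subtype.val) z =
      ∑ i ∈ s, (w i : ℝ) • charFun ((ν i : Measure F).map Subtype.val) z := by
  simp only [charFun_map_val]
  exact integral_mixture s w ν hw fun i _ =>
    integrable_of_continuous_compactSpace _ (by fun_prop)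

/-- The transform is linear in the measure and `|·|²` is convex. -/
lemma energy_mixture_le [CompactSpace F] {ι : Type*} (s : Finset ι) (w : ι → ℝ≥0)
    (ν : ι → ProbabilityMeasure F) (hw : ∑ i ∈ s, w i = 1) {R : ℝ} (hR : 0 < R) :
    energy ((mixture s w ν hw : Measure F).map Subtype.val) R ≤
      ∑ i ∈ s, (w i : ℝ) * energy ((ν i : Measure F).map Subtype.val) R := by
  have hint : ∀ μ : ProbabilityMeasure F, IntegrableOn
      (fun z => ‖charFun ((μ : Measure F).map Subtype.val) z‖ ^ 2) (Metric.closedBall 0 R) :=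
    fun μ => integrableOn_norm_charFun_sq _ _ _
  have hconv : ConvexOn ℝ univ fun z : ℂ => ‖z‖ ^ 2 :=
    convexOn_univ_norm.pow (fun z _ => norm_nonneg z) 2
  have hpt : ∀ z, ‖charFun ((mixture s w ν hw : Measure F).map Subtype.val) z‖ ^ 2 ≤
      ∑ i ∈ s, (w i : ℝ) * ‖charFun ((ν i : Measure F).map Subtype.val) z‖ ^ 2 := fun z => by
    rw [charFun_mixture]
    exact hconv.map_sum_le (fun i _ => (w i).coe_nonneg) (by exact_mod_cast hw)
      (fun i _ => mem_univ _)
  have hle := integral_mono (hint (mixture s w ν hw))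
    (integrable_finsetSum s fun i _ => (hint (ν i)).const_mul (w i : ℝ)) hpt
  rw [integral_finsetSum s fun i _ => (hint (ν i)).const_mul (w i : ℝ)] at hle
  simp only [integral_const_mul] at hle
  unfold energy
  calc _ ≤ (R ^ d)⁻¹ * ∑ i ∈ s, (w i : ℝ) * ∫ z in Metric.closedBall 0 R,
          ‖charFun ((ν i : Measure F).map Subtype.val) z‖ ^ 2 :=
        mul_le_mul_of_nonneg_left hle (by positivity)
    _ = _ := by
        rw [Finset.mul_sum]
        exact Finset.sum_congr rfl fun i _ => by ring

/-- The uniform probability measure on a non-empty finite set. -/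
noncomputable def uniform {Ω : Type*} [MeasurableSpace Ω] (Y : Finset Ω) (hY : Y.Nonempty) :
    ProbabilityMeasure Ω :=
  mixture Y (fun _ => (Y.card : ℝ≥0)⁻¹) diracProba
    (by simp [hY.card_pos.ne'])

lemma uniform_apply_eq_zero {Ω : Type*} [MeasurableSpace Ω] {Y : Finset Ω} (hY : Y.Nonempty)
    {A : Set Ω} (hA : MeasurableSet A) (h : ∀ y ∈ Y, y ∉ A) :
    (uniform Y hY : Measure Ω) A = 0 := by
  rw [uniform, mixture_toMeasure]
  simp only [Measure.coe_finsetSum, Finset.sum_apply, Measure.smul_apply]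
  refine Finset.sum_eq_zero fun y hy => ?_
  simp [diracProba_toMeasure_apply' y hA, h y hy]

lemma exists_energy_uniform_bound (d : ℕ) : ∃ C : ℝ, 0 < C ∧
    ∀ (F : Set (EuclideanSpace ℝ (Fin d))) [CompactSpace F] (Y : Finset F) (hY : Y.Nonempty)
      (R : ℝ), 0 < R → (∀ x ∈ Y, ∀ y ∈ Y, x ≠ y → R⁻¹ ≤ dist x y) →
      energy ((uniform Y hY : Measure F).map Subtype.val) R ≤ C / Y.card := by
  obtain ⟨C, hC, h⟩ := exists_expSum_bound d
  refine ⟨C, hC, fun F _ Y hY R hR hsep => ?_⟩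
  have hN : (0 : ℝ) < Y.card := by exact_mod_cast hY.card_pos
  have h1 := h (Y.map (Function.Embedding.subtype _)) R hR (by
    intro x hx y hy hxy
    obtain ⟨u, hu, rfl⟩ := Finset.mem_map.1 hx
    obtain ⟨v, hv, rfl⟩ := Finset.mem_map.1 hy
    exact hsep u hu v hv fun h => hxy (h ▸ rfl))
  simp only [Finset.sum_map, Finset.card_map, Function.Embedding.subtype_apply] at h1
  have hch : ∀ z, ‖charFun ((uniform Y hY : Measure F).map Subtype.val) z‖ ^ 2 =
      ((Y.card : ℝ)⁻¹) ^ 2 * ‖∑ y ∈ Y,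
        Complex.exp (inner ℝ (y : EuclideanSpace ℝ (Fin d)) z * Complex.I)‖ ^ 2 := fun z => by
    rw [uniform, charFun_mixture, ← Finset.smul_sum, norm_smul, mul_pow]
    simp [diracProba]
  unfold energy
  simp only [hch, integral_const_mul]
  calc _ = ((Y.card : ℝ)⁻¹) ^ 2 * ((R ^ d)⁻¹ * ∫ z in Metric.closedBall 0 R, ‖∑ y ∈ Y,
        Complex.exp (inner ℝ (y : EuclideanSpace ℝ (Fin d)) z * Complex.I)‖ ^ 2) := by ring
    _ ≤ ((Y.card : ℝ)⁻¹) ^ 2 * (C * Y.card) := mul_le_mul_of_nonneg_left h1 (by positivity)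
    _ = C / Y.card := by field_simp

/-- Take a `1/R`-separated subset of the local piece with at least `N_{2/R} > (R/2)^s` points. Its
uniform measure has energy at most `C (R/2)^{-s}`, and the gap `t < s` absorbs `C` and `2^s`. -/
lemma eventually_exists_uniform [CompactSpace F] {s t : ℝ} (hts : t < s) {y : F} {ε : ℝ}
    (hε : 0 < ε) (hy : (s : EReal) < lowerBoxDim (F ∩ Metric.closedBall (y : _) ε)) {R : ℕ → ℝ}
    (hR : Tendsto R atTop atTop) :
    ∀ᶠ k in atTop, ∃ ν : ProbabilityMeasure F,
      (ν : Measure F) (Metric.closedBall y ε)ᶜ = 0 ∧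
      energy ((ν : Measure F).map Subtype.val) (R k) < Real.exp (-t * Real.log (R k)) := by
  obtain ⟨C, hC, hbound⟩ := exists_energy_uniform_bound d
  have hr : Tendsto (fun k => 2 * (R k)⁻¹) atTop (𝓝[>] 0) := by
    refine tendsto_nhdsWithin_iff.2 ⟨by simpa using hR.inv_tendsto_atTop.const_mul 2, ?_⟩
    filter_upwards [hR.eventually_gt_atTop 0] with k hk
    exact mul_pos two_pos (inv_pos.2 hk)
  have hlog : Tendsto (fun k => Real.log (R k)) atTop atTop := Real.tendsto_log_atTop.comp hR
  filter_upwards [hr.eventually (eventually_lt_of_lt_liminf hy), hR.eventually_gt_atTop 2,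
    (hlog.const_mul_atTop (sub_pos.2 hts)).eventually_gt_atTop (Real.log C + s * Real.log 2)]
    with k h1 h2 h3
  have hRk : 0 < R k := by linarith
  obtain ⟨X, hX, hXA, hsep, hcard⟩ := exists_separated_finset
    (A := F ∩ Metric.closedBall (y : EuclideanSpace ℝ (Fin d)) ε)
    ⟨y, y.2, by simpa using hε.le⟩ (inv_pos.2 hRk)
  classical
  set Y : Finset F := X.subtype (· ∈ F)
  have hYX : Y.map (Function.Embedding.subtype _) = X :=
    Finset.subtype_map_of_mem fun x hx => (hXA hx).1
  have hYc : Y.card = X.card := by rw [← hYX, Finset.card_map]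
  have hmem : ∀ x ∈ Y, (x : EuclideanSpace ℝ (Fin d)) ∈ X := fun x hx => by
    simpa [Y] using hx
  have hYn : Y.Nonempty := Finset.card_pos.1 (hYc ▸ hX.card_pos)
  refine ⟨uniform Y hYn, ?_, ?_⟩
  · refine uniform_apply_eq_zero hYn Metric.isClosed_closedBall.measurableSet.compl
      fun x hx hn => hn ?_
    exact (hXA (hmem x hx)).2
  · refine (hbound F Y hYn (R k) hRk fun u hu v hv huv =>
      hsep u (hmem u hu) v (hmem v hv) (fun h => huv (Subtype.ext h))).trans_lt ?_
    have hN : (0 : ℝ) < Y.card := by exact_mod_cast hYn.card_pos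
    rw [EReal.coe_lt_coe_iff, ← Real.log_inv, lt_div_iff₀ (Real.log_pos (by
      rw [mul_inv, inv_inv]; linarith)), mul_inv, inv_inv,
      Real.log_mul (by norm_num) hRk.ne', Real.log_inv] at h1
    have h4 : Real.log (coverNum (2 * (R k)⁻¹)
        (F ∩ Metric.closedBall (y : EuclideanSpace ℝ (Fin d)) ε)) ≤ Real.log Y.card := by
      rw [hYc]
      rcases Nat.eq_zero_or_pos (coverNum (2 * (R k)⁻¹)
        (F ∩ Metric.closedBall (y : EuclideanSpace ℝ (Fin d)) ε)) with h0 | h0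
      -- A zero covering number is harmless, since `Real.log 0 = 0`.
      · rw [h0, Nat.cast_zero, Real.log_zero]
        exact Real.log_natCast_nonneg _
      · exact Real.log_le_log (by exact_mod_cast h0) (by exact_mod_cast hcard)
    rw [← Real.log_lt_iff_lt_exp (by positivity), Real.log_div hC.ne' hN.ne']
    nlinarith

/-- Finitely many centres share one large `k`, and convexity passes the energy bound to every
mixture of their local measures. -/
lemma dense_setOf_energy_lt [CompactSpace F] {s t : ℝ} (hts : t < s)
    (hF : ∀ x ∈ F, ∀ ε > 0, (s : EReal) < lowerBoxDim (F ∩ Metric.closedBall x ε))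
    {R : ℕ → ℝ} (hR : Tendsto R atTop atTop) (n : ℕ) :
    Dense {μ : ProbabilityMeasure F | ∃ k ≥ n,
      energy ((μ : Measure F).map Subtype.val) (R k) < Real.exp (-t * Real.log (R k))} := by
  refine dense_of_forall_mixture_mem _ fun Y ε hε => ?_
  have hev := (Filter.eventually_all_finset Y).2 fun y _ =>
    eventually_exists_uniform hts hε (hF y y.2 ε hε) hR
  obtain ⟨k, h1, h2, h3⟩ :=
    (hev.and ((eventually_ge_atTop n).and (hR.eventually_gt_atTop 0))).exists
  have : ∀ y : F, ∃ ν : ProbabilityMeasure F, y ∈ Y →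
      (ν : Measure F) (Metric.closedBall y ε)ᶜ = 0 ∧
      energy ((ν : Measure F).map Subtype.val) (R k) < Real.exp (-t * Real.log (R k)) :=
    fun y => by
      by_cases hy : y ∈ Y
      · obtain ⟨ν, hν⟩ := h1 y hy
        exact ⟨ν, fun _ => hν⟩
      · exact ⟨diracProba y, fun h => absurd h hy⟩
  choose ν hν using this
  refine ⟨ν, fun y hy => (hν y hy).1, fun w hw => ⟨k, h2, ?_⟩⟩
  refine (energy_mixture_le Y w ν hw h3).trans_lt ?_
  have hw' : ∑ y ∈ Y, (w y : ℝ) = 1 := by exact_mod_cast hw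
  -- A positive weight is needed to keep the inequality strict.
  obtain ⟨y, hy, hy0⟩ : ∃ y ∈ Y, w y ≠ 0 := by
    by_contra! h
    rw [Finset.sum_eq_zero h] at hw
    exact zero_ne_one hw
  calc _ < ∑ y ∈ Y, (w y : ℝ) * Real.exp (-t * Real.log (R k)) := by
        refine Finset.sum_lt_sum
          (fun i hi => mul_le_mul_of_nonneg_left (hν i hi).2.le (w i).coe_nonneg) ⟨y, hy, ?_⟩
        exact mul_lt_mul_of_pos_left (hν y hy).2 (by exact_mod_cast pos_iff_ne_zero.2 hy0)
    _ = _ := by rw [← Finset.sum_mul, hw', one_mul]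

lemma exists_measure_le_limsup (hFc : IsCompact F) (hne : F.Nonempty) {s t : ℝ} (hts : t < s)
    (hF : ∀ x ∈ F, ∀ ε > 0, (s : EReal) < lowerBoxDim (F ∩ Metric.closedBall x ε))
    {R : ℕ → ℝ} (hR : Tendsto R atTop atTop) :
    ∃ μ : Measure (EuclideanSpace ℝ (Fin d)), (IsProbabilityMeasure μ ∧ μ.support = F) ∧
      (t : EReal) ≤ limsup (fun k => ((fourierExponent μ (R k) : ℝ) : EReal)) atTop := by
  have : CompactSpace F := isCompact_iff_compactSpace.1 hFc
  have : Nonempty F := hne.to_subtype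
  obtain ⟨μ, hG, hball⟩ := exists_mem_iInter_forall_ball_pos
    (fun n => {μ : ProbabilityMeasure F | ∃ k ≥ n,
      energy ((μ : Measure F).map Subtype.val) (R k) < Real.exp (-t * Real.log (R k))})
    (fun n => by
      simp only [ge_iff_le, ofPred_exists, ofPred_and]
      refine isOpen_iUnion fun k => isOpen_const.inter ?_
      exact isOpen_lt (continuous_energy_map_val (R k)) continuous_const)
    (dense_setOf_energy_lt hts hF hR)
  have hFm : (μ : Measure F).map Subtype.val F = 1 := by
    rw [Measure.map_apply measurable_subtype_coe hFc.measurableSet]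
    simp
  refine ⟨(μ : Measure F).map Subtype.val, ⟨inferInstance, ?_⟩, ?_⟩
  · apply subset_antisymm
    · refine Measure.support_subset_of_isClosed hFc.isClosed ?_
      exact (prob_compl_eq_zero_iff hFc.measurableSet).2 hFm
    · intro x hx
      refine (Metric.nhds_basis_ball.mem_measureSupport).2 fun ε hε => ?_
      rw [Measure.map_apply measurable_subtype_coe Metric.isOpen_ball.measurableSet]
      exact hball ⟨x, hx⟩ ε hε
  · refine le_limsup_of_frequently_le ?_
    obtain ⟨N, hN⟩ := eventually_atTop.1 (hR.eventually_gt_atTop 1)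
    refine frequently_atTop.2 fun n => ?_
    -- Going beyond `N` ensures `log (R k) > 0`, needed to convert the energy bound into an exponent
    -- bound.
    obtain ⟨k, hk, hlt⟩ := hG (max n N)
    refine ⟨k, (le_max_left _ _).trans hk, ?_⟩
    have h1 : 1 < R k := hN k ((le_max_right _ _).trans hk)
    have hE := energy_pos_of_isCompact ((μ : Measure F).map Subtype.val) hFc
      (by simp [Measure.real, hFm]) (one_pos.trans h1)
    rw [EReal.coe_le_coe_iff, fourierExponent_eq, div_neg, ← neg_div,
      le_div_iff₀ (Real.log_pos h1)]
    have := (Real.log_lt_iff_lt_exp hE).2 hlt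
    linarith

end Energy

theorem modLowerBoxDim_le_iSup (E : Set (EuclideanSpace ℝ (Fin d))) (hE : IsCompact E)
    (hne : E.Nonempty) :
    modLowerBoxDim E ≤
      ⨆ (F : Set (EuclideanSpace ℝ (Fin d))) (_ : F ⊆ E),
        ⨅ (R : ℕ → ℝ) (_ : Monotone R ∧ Tendsto R atTop atTop),
          ⨆ (μ : Measure (EuclideanSpace ℝ (Fin d)))
            (_ : IsProbabilityMeasure μ ∧ μ.support = F),
            limsup (fun k : ℕ => ((fourierExponent μ (R k) : ℝ) : EReal)) atTop := by
  refine EReal.ge_of_forall_gt_iff_ge.1 fun t ht => ?_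
  obtain ⟨s, hts, hs⟩ := EReal.lt_iff_exists_real_btwn.1 ht
  obtain ⟨F, hFE, hFc, hFn, hF⟩ := exists_core hE
    fun h => (h.modLowerBoxDim_le hne).not_gt hs
  refine le_iSup₂_of_le F hFE (le_iInf₂ fun R hR => ?_)
  obtain ⟨μ, hμ, hle⟩ := exists_measure_le_limsup hFc hFn (EReal.coe_lt_coe_iff.1 hts) hF hR.2
  exact le_iSup₂_of_le μ hμ hle

end FractalDim

theorem mainTheorem10 (d : ℕ) (E : Set (EuclideanSpace ℝ (Fin d)))
    (hE : IsCompact E) (hne : E.Nonempty) :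
    FractalDim.modLowerBoxDim E =
      ⨆ (F : Set (EuclideanSpace ℝ (Fin d))) (_ : F ⊆ E),
        ⨅ (R : ℕ → ℝ) (_ : Monotone R ∧ Tendsto R atTop atTop),
          ⨆ (μ : Measure (EuclideanSpace ℝ (Fin d)))
            (_ : IsProbabilityMeasure μ ∧ μ.support = F),
            limsup (fun k : ℕ => ((FractalDim.fourierExponent μ (R k) : ℝ) : EReal)) atTop :=
  le_antisymm (FractalDim.modLowerBoxDim_le_iSup E hE hne)
    (FractalDim.iSup_le_modLowerBoxDim E hE)
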